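/- Let $A$ be an operator algebra, that is, a norm-closed (not necessarily selfadjoint, not necessarily unital) complex subalgebra of $B(H)$ for a complex Hilbert space $H$. Let $1$ denote the identity of $A$ if $A$ has an identity of norm one, and the identity operator $I_H$ otherwise (the identity of the unitization $A + \mathbb{C} I_H$). Put $$\mathfrak F_A = \{x \in A : \|1 - x\| \le 1\}, \qquad \mathfrak r_A = \{a \in A : a + a^* \ge 0\},$$ and let $A_H$ be the closed linear span of the products $x a y$ with $x, y \in \mathfrak F_A$ and $a \in A$; this is again a closed subalgebra of $B(H)$. Then: (1) $A_H = \overline{\mathrm{Span}}(\mathfrak r_A)$, and $\mathfrak r_A = \mathfrak r_{A_H} \subset A_H$. (2) $A$ has a contractive approximate identity (a net $(e_t)$ in $A$ with $\|e_t\| \le 1$ and $e_t a \to a$, $a e_t \to a$ for all $a \in A$) if and only if $A = \overline{\mathrm{Span}}(\mathfrak r_A)$. -/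

import Mathlib

noncomputable section

namespace OperatorAlgebra

variable {H : Type*} [NormedAddCommGroup H] [InnerProductSpace ℂ H]

/-- `e` is an identity element of norm one of the algebra `A` of operators on `H`. It need not be
the identity operator of `H`. -/
def IsNormOneIdentity (A : NonUnitalSubalgebra ℂ (H →L[ℂ] H)) (e : H →L[ℂ] H) : Prop :=
  e ∈ A ∧ ‖e‖ = 1 ∧ ∀ a ∈ A, e * a = a ∧ a * e = a

open Classical in
/-- The identity of the unitization `A¹` of `A`. If `A` has an identity of norm one then `A¹ = A`
and this is that (unique) identity; otherwise `A¹ = A + ℂ I_H` and this is `I_H`. -/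
def unitizationOne (A : NonUnitalSubalgebra ℂ (H →L[ℂ] H)) : H →L[ℂ] H :=
  if h : ∃ e, IsNormOneIdentity A e then h.choose else 1

/-- `𝔉_A = {x ∈ A : ‖1 - x‖ ≤ 1}`, where `1` is the identity of the unitization of `A`. -/
def frakF (A : NonUnitalSubalgebra ℂ (H →L[ℂ] H)) : Set (H →L[ℂ] H) :=
  {x | x ∈ A ∧ ‖unitizationOne A - x‖ ≤ 1}

/-- `𝔯_A = {a ∈ A : a + a* ≥ 0}`, positivity being that of operators on `H`. -/
def frakR [CompleteSpace H] (A : NonUnitalSubalgebra ℂ (H →L[ℂ] H)) : Set (H →L[ℂ] H) :=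
  {a | a ∈ A ∧ 0 ≤ a + star a}

/-- The products `x a y` with `x, y ∈ 𝔉_A` and `a ∈ A`. -/
def tripleProducts (A : NonUnitalSubalgebra ℂ (H →L[ℂ] H)) : Set (H →L[ℂ] H) :=
  {z | ∃ x ∈ frakF A, ∃ a ∈ A, ∃ y ∈ frakF A, z = x * a * y}

theorem mul_mem_tripleProducts (A : NonUnitalSubalgebra ℂ (H →L[ℂ] H)) {z w : H →L[ℂ] H}
    (hz : z ∈ tripleProducts A) (hw : w ∈ tripleProducts A) : z * w ∈ tripleProducts A := by
  obtain ⟨x, hx, a, ha, y, hy, rfl⟩ := hz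
  obtain ⟨x', hx', a', ha', y', hy', rfl⟩ := hw
  exact ⟨x, hx, a * y * x' * a',
    A.mul_mem (A.mul_mem (A.mul_mem ha hy.1) hx'.1) ha', y', hy', by simp only [mul_assoc]⟩

/-- The linear span of the products `x a y` with `x, y ∈ 𝔉_A` and `a ∈ A`, as an algebra. -/
def spanTripleProducts (A : NonUnitalSubalgebra ℂ (H →L[ℂ] H)) :
    NonUnitalSubalgebra ℂ (H →L[ℂ] H) where
  toSubmodule := Submodule.span ℂ (tripleProducts A)
  mul_mem' := by
    intro z w hz hw
    change z ∈ Submodule.span ℂ (tripleProducts A) at hz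
    change w ∈ Submodule.span ℂ (tripleProducts A) at hw
    change z * w ∈ Submodule.span ℂ (tripleProducts A)
    induction hz, hw using Submodule.span_induction₂ with
    | mem_mem x y hx hy => exact Submodule.subset_span (mul_mem_tripleProducts A hx hy)
    | zero_left y hy => simp
    | zero_right x hx => simp
    | add_left x y z hx hy hz h1 h2 => rw [add_mul]; exact add_mem h1 h2
    | add_right x y z hx hy hz h1 h2 => rw [mul_add]; exact add_mem h1 h2
    | smul_left r x y hx hy h => rw [smul_mul_assoc]; exact Submodule.smul_mem _ r h
    | smul_right r x y hx hy h => rw [mul_smul_comm]; exact Submodule.smul_mem _ r h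

/-- `A_H`, the closed linear span of the products `x a y` with `x, y ∈ 𝔉_A` and `a ∈ A`. -/
def hereditaryPart (A : NonUnitalSubalgebra ℂ (H →L[ℂ] H)) :
    NonUnitalSubalgebra ℂ (H →L[ℂ] H) :=
  (spanTripleProducts A).topologicalClosure

/-- `A` has a contractive approximate identity: a net (here, a filter) in the closed unit ball of
`A` along which `e * a → a` and `a * e → a` for every `a ∈ A`. -/
def HasCai (A : NonUnitalSubalgebra ℂ (H →L[ℂ] H)) : Prop :=
  ∃ l : Filter A, l.IsApproximateUnit ∧ ∀ᶠ e in l, ‖e‖ ≤ 1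

end OperatorAlgebra

end

open Filter Topology
open scoped InnerProductSpace

namespace OperatorAlgebra

variable {H : Type*} [NormedAddCommGroup H] [InnerProductSpace ℂ H]

/-! ### Estimates for accretive operators and contractive idempotents -/

section Operators

/-! Everything rests on accretivity, Re⟨xξ, ξ⟩ ≥ 0, and its strong form ‖xξ‖² ≤ 2 Re⟨xξ, ξ⟩, which
is what ‖1 - x‖ ≤ 1 means.

(1) If x ∈ A is accretive, then y = tx(1 + tx)⁻¹ lies in 𝔉_A and y x y → x as t → ∞
(`exists_frakF_resolvent`), so 𝔯_A ⊆ A_H. Conversely, for ‖a‖ ≤ 1 the product x a y is the accretive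
element x + y + x a y minus x and y (`add_add_mul_mul_mem_frakR`).

(2) If A = A_H, such resolvents of finite sums from 𝔉_A form a contractive approximate identity,
because the real part of a sum dominates that of each summand. Conversely, for a ∈ A a geometrically
convergent series of multiples of approximate units has a sum d ∈ A with d ± a accretive
(`mem_span_frakR_of_hasCai`), and 2a = (d + a) - (d - a). -/

theorem norm_apply_sq_le_of_norm_one_sub_le {x : H →L[ℂ] H} (hx : ‖1 - x‖ ≤ 1) (ξ : H) :
    ‖x ξ‖ ^ 2 ≤ 2 * RCLike.re ⟪x ξ, ξ⟫_ℂ := by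
  have h : ‖ξ - x ξ‖ ≤ ‖ξ‖ := by simpa using (1 - x).le_of_opNorm_le hx ξ
  have h2 := norm_sub_sq (𝕜 := ℂ) ξ (x ξ)
  have h3 : ‖ξ - x ξ‖ ^ 2 ≤ ‖ξ‖ ^ 2 := by gcongr
  rw [inner_re_symm (𝕜 := ℂ)] at h2
  linarith

theorem neg_norm_mul_sq_le_re_inner (x : H →L[ℂ] H) (ξ : H) :
    -(‖x‖ * ‖ξ‖ ^ 2) ≤ RCLike.re ⟪x ξ, ξ⟫_ℂ := by
  have h1 := (abs_le.1 ((RCLike.abs_re_le_norm _).trans (norm_inner_le_norm (𝕜 := ℂ) (x ξ) ξ))).1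
  have h2 : ‖x ξ‖ * ‖ξ‖ ≤ ‖x‖ * ‖ξ‖ * ‖ξ‖ := by gcongr; exact x.le_opNorm ξ
  nlinarith

/-- An operator whose real part dominates that of `x`, `‖1 - x‖ ≤ 1`, controls `x`. -/
theorem norm_mul_sq_le_of_re_inner_le {x z R : H →L[ℂ] H} (hx : ‖1 - x‖ ≤ 1) (hR : ‖R‖ ≤ 1)
    (hxz : ∀ ξ, RCLike.re ⟪x ξ, ξ⟫_ℂ ≤ RCLike.re ⟪z ξ, ξ⟫_ℂ) :
    ‖x * R‖ ^ 2 ≤ 2 * ‖z * R‖ := by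
  have h : ‖x * R‖ ≤ √(2 * ‖z * R‖) := by
    refine ContinuousLinearMap.opNorm_le_bound _ (Real.sqrt_nonneg _) fun ξ => ?_
    refine le_of_sq_le_sq ?_ (by positivity)
    rw [mul_pow, Real.sq_sqrt (by positivity)]
    have h1 := norm_apply_sq_le_of_norm_one_sub_le hx (R ξ)
    have h2 : RCLike.re ⟪z (R ξ), R ξ⟫_ℂ ≤ ‖z * R‖ * ‖ξ‖ * ‖ξ‖ :=
      (re_inner_le_norm _ _).trans (mul_le_mul ((z * R).le_opNorm ξ)
        (by simpa using R.le_of_opNorm_le hR ξ) (norm_nonneg _) (by positivity))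
    have h3 := hxz (R ξ)
    change ‖x (R ξ)‖ ^ 2 ≤ _
    nlinarith
  calc ‖x * R‖ ^ 2 ≤ √(2 * ‖z * R‖) ^ 2 := by gcongr
    _ = _ := Real.sq_sqrt (by positivity)

/-- In ξ = Rξ + wRξ the two summands have nonnegative real inner product, so their squared norms sum
to at most ‖ξ‖². -/
theorem norm_le_one_of_accretive_of_mul_eq_one {w R : H →L[ℂ] H}
    (hw : ∀ ξ, 0 ≤ RCLike.re ⟪w ξ, ξ⟫_ℂ) (hR : (1 + w) * R = 1) : ‖R‖ ≤ 1 ∧ ‖w * R‖ ≤ 1 := by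
  have key : ∀ ξ, ‖R ξ‖ ^ 2 + ‖w (R ξ)‖ ^ 2 ≤ ‖ξ‖ ^ 2 := fun ξ => by
    have h1 : R ξ + w (R ξ) = ξ := by simpa using congr($hR ξ)
    have h2 := norm_add_sq (𝕜 := ℂ) (R ξ) (w (R ξ))
    have h3 := hw (R ξ)
    rw [h1, inner_re_symm (𝕜 := ℂ)] at h2
    linarith
  constructor <;> refine ContinuousLinearMap.opNorm_le_bound _ zero_le_one fun ξ => ?_ <;>
    rw [one_mul] <;> refine le_of_sq_le_sq ?_ (norm_nonneg _)
  · nlinarith [key ξ, sq_nonneg ‖w (R ξ)‖]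
  · change ‖w (R ξ)‖ ^ 2 ≤ _
    nlinarith [key ξ, sq_nonneg ‖R ξ‖]

/-- If `w ∈ A` is accretive then `w (1 + w)⁻¹ ∈ A`. -/
theorem exists_mem_resolvent [CompleteSpace H] {A : NonUnitalSubalgebra ℂ (H →L[ℂ] H)}
    (hA : IsClosed (A : Set (H →L[ℂ] H))) {w : H →L[ℂ] H} (hwA : w ∈ A)
    (hw : ∀ ξ, 0 ≤ RCLike.re ⟪w ξ, ξ⟫_ℂ) :
    ∃ R : H →L[ℂ] H, (1 + w) * R = 1 ∧ R * (1 + w) = 1 ∧ w * R ∈ A := by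
  -- Write 1 + w = (1 + s)(1 - u) with u = (s - w)/(1 + s). Accretivity gives ‖s - w‖² ≤ s² + s < (1
  -- + s)², so the Neumann series in u converges, and each w uⁿ stays in A.
  set s : ℝ := ‖w‖ ^ 2 with hs
  have hs0 : 0 ≤ s := by positivity
  set u : H →L[ℂ] H := ((1 + s : ℝ) : ℂ)⁻¹ • ((s : ℂ) • 1 - w) with hu
  have hs1 : ((1 + s : ℝ) : ℂ) ≠ 0 := by exact_mod_cast (by positivity : (1 + s) ≠ 0)
  have hnorm : ‖(s : ℂ) • (1 : H →L[ℂ] H) - w‖ ≤ √(s ^ 2 + s) := by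
    refine ContinuousLinearMap.opNorm_le_bound _ (Real.sqrt_nonneg _) fun ξ => ?_
    refine le_of_sq_le_sq ?_ (by positivity)
    rw [mul_pow, Real.sq_sqrt (by positivity)]
    have h1 := norm_sub_sq (𝕜 := ℂ) ((s : ℂ) • ξ) (w ξ)
    have h2 : RCLike.re ⟪(s : ℂ) • ξ, w ξ⟫_ℂ = s * RCLike.re ⟪w ξ, ξ⟫_ℂ := by
      rw [inner_re_symm (𝕜 := ℂ), inner_smul_right]
      simp
    have h3 : ‖w ξ‖ ^ 2 ≤ s * ‖ξ‖ ^ 2 := by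
      rw [hs, ← mul_pow]; gcongr; exact w.le_opNorm ξ
    have h4 : ‖(s : ℂ) • ξ‖ ^ 2 = s ^ 2 * ‖ξ‖ ^ 2 := by
      rw [norm_smul, mul_pow, Complex.norm_real, Real.norm_eq_abs, sq_abs]
    have h5 := mul_nonneg hs0 (hw ξ)
    simp only [sub_apply, smul_apply,
      one_apply_eq_self]
    rw [h1, h2, h4]
    linarith
  have hu1 : ‖u‖ < 1 := by
    rw [hu, norm_smul, norm_inv, Complex.norm_real, Real.norm_of_nonneg (by positivity),
      inv_mul_lt_one₀ (by positivity)]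
    refine hnorm.trans_lt ((Real.sqrt_lt' (by positivity)).2 ?_)
    nlinarith
  have hone : 1 + w = ((1 + s : ℝ) : ℂ) • (1 - u) := by
    rw [hu, smul_sub, smul_inv_smul₀ hs1]
    push_cast
    module
  refine ⟨((1 + s : ℝ) : ℂ)⁻¹ • ∑' n : ℕ, u ^ n, ?_, ?_, ?_⟩
  · rw [hone, smul_mul_smul_comm, mul_neg_geom_series u hu1, mul_inv_cancel₀ hs1, one_smul]
  · rw [hone, smul_mul_smul_comm, geom_series_mul_neg u hu1, inv_mul_cancel₀ hs1, one_smul]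
  · rw [mul_smul_comm]
    refine SMulMemClass.smul_mem _ ?_
    rw [← (summable_geometric_of_norm_lt_one hu1).tsum_mul_left]
    refine tsum_mem hA fun n => ?_
    induction n with
    | zero => simpa using hwA
    | succ n ih =>
      rw [pow_succ, ← mul_assoc, hu, mul_smul_comm, mul_sub, mul_smul_comm, mul_one]
      exact SMulMemClass.smul_mem _ (sub_mem (SMulMemClass.smul_mem _ ih) (mul_mem ih hwA))

variable [CompleteSpace H]

theorem re_inner_star_apply (a : H →L[ℂ] H) (ξ : H) :
    RCLike.re ⟪(star a) ξ, ξ⟫_ℂ = RCLike.re ⟪a ξ, ξ⟫_ℂ := by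
  rw [ContinuousLinearMap.star_eq_adjoint, ContinuousLinearMap.adjoint_inner_left,
    inner_re_symm (𝕜 := ℂ)]

theorem nonneg_add_star_iff (a : H →L[ℂ] H) :
    0 ≤ a + star a ↔ ∀ ξ, 0 ≤ RCLike.re ⟪a ξ, ξ⟫_ℂ := by
  have hsa : IsSelfAdjoint (a + star a) := IsSelfAdjoint.add_star_self a
  rw [ContinuousLinearMap.nonneg_iff_isPositive, ContinuousLinearMap.isPositive_def',
    and_iff_right hsa]
  refine forall_congr' fun ξ => ?_
  rw [ContinuousLinearMap.reApplyInnerSelf_apply, add_apply, inner_add_left,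
    map_add, re_inner_star_apply]
  constructor <;> intro h <;> linarith

/-- For η = xξ, expanding the square gives ‖e*η - η‖² ≤ 2 Re⟨η - eη, η⟩. Thus e x → x forces e* x →
x, although e* need not lie in A. -/
theorem norm_star_mul_sub_sq_le {e : H →L[ℂ] H} (he : ‖e‖ ≤ 1) (x : H →L[ℂ] H) :
    ‖star e * x - x‖ ^ 2 ≤ 2 * ‖x‖ * ‖e * x - x‖ := by
  have h : ‖star e * x - x‖ ≤ √(2 * ‖x‖ * ‖e * x - x‖) := by
    refine ContinuousLinearMap.opNorm_le_bound _ (Real.sqrt_nonneg _) fun ξ => ?_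
    refine le_of_sq_le_sq ?_ (by positivity)
    rw [mul_pow, Real.sq_sqrt (by positivity)]
    change ‖(star e) (x ξ) - x ξ‖ ^ 2 ≤ _
    have h1 := norm_sub_sq (𝕜 := ℂ) ((star e) (x ξ)) (x ξ)
    rw [re_inner_star_apply] at h1
    have h2 : ‖(star e) (x ξ)‖ ≤ ‖x ξ‖ := by
      simpa using (star e).le_of_opNorm_le ((norm_star e).trans_le he) (x ξ)
    have h3 : ‖(star e) (x ξ)‖ ^ 2 ≤ ‖x ξ‖ ^ 2 := by gcongr
    have h4 : RCLike.re ⟪x ξ - e (x ξ), x ξ⟫_ℂ ≤ ‖e * x - x‖ * ‖ξ‖ * (‖x‖ * ‖ξ‖) := by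
      refine (re_inner_le_norm _ _).trans ?_
      rw [norm_sub_rev]
      exact mul_le_mul ((e * x - x).le_opNorm ξ) (x.le_opNorm ξ) (norm_nonneg _) (by positivity)
    rw [inner_sub_left, map_sub, inner_self_eq_norm_sq] at h4
    nlinarith
  calc ‖star e * x - x‖ ^ 2 ≤ √(2 * ‖x‖ * ‖e * x - x‖) ^ 2 := by gcongr
    _ = _ := Real.sq_sqrt (by positivity)

/-- A contractive idempotent is selfadjoint. -/
theorem isSelfAdjoint_of_isIdempotentElem_of_norm_le_one {e : H →L[ℂ] H}
    (he : IsIdempotentElem e) (he1 : ‖e‖ ≤ 1) : IsSelfAdjoint e := by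
  have h := norm_star_mul_sub_sq_le he1 e
  rw [he.eq, sub_self, norm_zero, mul_zero] at h
  have h0 : star e * e = e := by
    rw [← sub_eq_zero, ← norm_eq_zero]
    exact pow_eq_zero_iff two_ne_zero |>.1 (le_antisymm h (by positivity))
  rw [← h0]
  exact IsSelfAdjoint.star_mul_self e

/-- Here e is an orthogonal projection, and 1 - x is e - x on its range plus the identity on the
complement. Hence 𝔉_A can be tested against I_H even when A has its own identity. -/
theorem norm_sub_le_one_iff_of_isIdempotentElem {e x : H →L[ℂ] H} (he : IsIdempotentElem e)
    (he1 : ‖e‖ ≤ 1) (hex : e * x = x) (hxe : x * e = x) : ‖e - x‖ ≤ 1 ↔ ‖1 - x‖ ≤ 1 := by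
  constructor
  · intro h
    refine ContinuousLinearMap.opNorm_le_bound _ zero_le_one fun ξ => ?_
    rw [one_mul]
    refine le_of_sq_le_sq ?_ (norm_nonneg _)
    have hsa := isSelfAdjoint_of_isIdempotentElem_of_norm_le_one he he1
    have horth : ∀ η, ⟪e η, ξ - e ξ⟫_ℂ = 0 := fun η => by
      rw [← ContinuousLinearMap.adjoint_inner_right, ← ContinuousLinearMap.star_eq_adjoint,
        hsa.star_eq, map_sub, show e (e ξ) = e ξ from congr($he.eq ξ), sub_self, inner_zero_right]
    have h1 : (1 - x) ξ = e ((e - x) (e ξ)) + (ξ - e ξ) := by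
      have h2 : e (x (e ξ)) = x ξ := congr($(show e * (x * e) = x by rw [hxe, hex]) ξ)
      have h3 : e (e ξ) = e ξ := congr($he.eq ξ)
      simp [h2, h3]
    have h4 := norm_add_sq (𝕜 := ℂ) (e ((e - x) (e ξ))) (ξ - e ξ)
    have h5 := norm_add_sq (𝕜 := ℂ) (e ξ) (ξ - e ξ)
    rw [horth, map_zero] at h4 h5
    rw [add_sub_cancel] at h5
    have h6 : ‖e ((e - x) (e ξ))‖ ≤ ‖e ξ‖ := by
      have h7 := e.le_of_opNorm_le he1 ((e - x) (e ξ))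
      have h8 := (e - x).le_of_opNorm_le h (e ξ)
      linarith
    have h9 : ‖e ((e - x) (e ξ))‖ ^ 2 ≤ ‖e ξ‖ ^ 2 := by gcongr
    rw [h1]
    linarith
  · intro h
    have h1 : e - x = e * (1 - x) := by rw [mul_sub, mul_one, hex]
    rw [h1]
    exact (norm_mul_le _ _).trans (mul_le_one₀ he1 (norm_nonneg _) h)

/-- Compressing by `(1 + e) / 2` halves a negative lower bound of the real part, up to `e`. -/
theorem neg_half_le_re_inner_compress_add {x e : H →L[ℂ] H} {η : ℝ} (hη : 0 ≤ η) (he : ‖e‖ ≤ 1)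
    (hx : ∀ ξ, -(η * ‖ξ‖ ^ 2) ≤ RCLike.re ⟪x ξ, ξ⟫_ℂ) (ξ : H) :
    -(η / 2 * ‖ξ‖ ^ 2) ≤ RCLike.re ⟪(star ((2⁻¹ : ℂ) • (1 + e)) * x * ((2⁻¹ : ℂ) • (1 + e)) +
      ((η / 2 : ℝ) : ℂ) • e) ξ, ξ⟫_ℂ := by
  set f : H →L[ℂ] H := (2⁻¹ : ℂ) • (1 + e) with hf
  have h1 : RCLike.re ⟪(star f * x * f + ((η / 2 : ℝ) : ℂ) • e) ξ, ξ⟫_ℂ =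
      RCLike.re ⟪x (f ξ), f ξ⟫_ℂ + η / 2 * RCLike.re ⟪e ξ, ξ⟫_ℂ := by
    rw [add_apply, inner_add_left, map_add, smul_apply,
      inner_smul_left, Complex.conj_ofReal]
    change RCLike.re ⟪(star f) (x (f ξ)), ξ⟫_ℂ + _ = _
    rw [ContinuousLinearMap.star_eq_adjoint, ContinuousLinearMap.adjoint_inner_left]
    simp
  -- The term Re⟨eξ, ξ⟩ in this bound is exactly what the summand (η/2)e compensates.
  have h2 : ‖f ξ‖ ^ 2 ≤ (‖ξ‖ ^ 2 + RCLike.re ⟪e ξ, ξ⟫_ℂ) / 2 := by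
    have h3 : ‖f ξ‖ = 2⁻¹ * ‖ξ + e ξ‖ := by
      rw [hf]
      change ‖(2⁻¹ : ℂ) • (ξ + e ξ)‖ = _
      simp [norm_smul, -smul_add]
    have h4 := norm_add_sq (𝕜 := ℂ) ξ (e ξ)
    have h5 : ‖e ξ‖ ≤ ‖ξ‖ := by simpa using e.le_of_opNorm_le he ξ
    have h6 : ‖e ξ‖ ^ 2 ≤ ‖ξ‖ ^ 2 := by gcongr
    rw [inner_re_symm (𝕜 := ℂ)] at h4
    rw [h3, mul_pow, h4]
    linarith
  have h7 := mul_le_mul_of_nonneg_left h2 hη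
  have h8 := hx (f ξ)
  rw [h1]
  linarith

end Operators

/-! ### The hereditary part as the closed span of the accretive elements -/

section Algebras

variable {A : NonUnitalSubalgebra ℂ (H →L[ℂ] H)}

theorem hereditaryPart_le (hA : IsClosed (A : Set (H →L[ℂ] H))) : hereditaryPart A ≤ A := by
  refine NonUnitalSubalgebra.topologicalClosure_minimal ?_ hA
  change Submodule.span ℂ (tripleProducts A) ≤ A.toSubmodule
  refine Submodule.span_le.2 ?_
  rintro _ ⟨x, hx, a, ha, y, hy, rfl⟩
  exact A.mul_mem (A.mul_mem hx.1 ha) hy.1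

theorem toSubmodule_hereditaryPart :
    (hereditaryPart A).toSubmodule = (Submodule.span ℂ (tripleProducts A)).topologicalClosure :=
  rfl

variable [CompleteSpace H]

theorem mem_frakF_iff {x : H →L[ℂ] H} : x ∈ frakF A ↔ x ∈ A ∧ ‖1 - x‖ ≤ 1 := by
  refine and_congr_right fun hx => ?_
  unfold unitizationOne
  split_ifs with h
  · obtain ⟨he, he1, hid⟩ := h.choose_spec
    exact norm_sub_le_one_iff_of_isIdempotentElem (hid _ he).1 he1.le (hid x hx).1 (hid x hx).2
  · rfl

theorem mem_frakR_iff {a : H →L[ℂ] H} :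
    a ∈ frakR A ↔ a ∈ A ∧ ∀ ξ, 0 ≤ RCLike.re ⟪a ξ, ξ⟫_ℂ :=
  and_congr_right fun _ => nonneg_add_star_iff a

theorem frakF_subset_frakR : frakF A ⊆ frakR A := fun x hx => by
  rw [mem_frakF_iff] at hx
  refine mem_frakR_iff.2 ⟨hx.1, fun ξ => ?_⟩
  have := norm_apply_sq_le_of_norm_one_sub_le hx.2 ξ
  nlinarith [sq_nonneg ‖x ξ‖]

/-- Take y = tx(1 + tx)⁻¹. Then 1 - y = (1 + tx)⁻¹ is a contraction, and tx(1 - y) = y = (1 - y)tx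
is one too. -/
theorem exists_frakF_resolvent (hA : IsClosed (A : Set (H →L[ℂ] H))) {x : H →L[ℂ] H}
    (hx : x ∈ frakR A) {t : ℝ} (ht : 0 < t) :
    ∃ y ∈ frakF A, ‖y‖ ≤ 1 ∧ ‖x * (1 - y)‖ ≤ t⁻¹ ∧ ‖(1 - y) * x‖ ≤ t⁻¹ := by
  rw [mem_frakR_iff] at hx
  have hw : ∀ ξ, 0 ≤ RCLike.re ⟪((t : ℂ) • x) ξ, ξ⟫_ℂ := fun ξ => by
    rw [smul_apply, inner_smul_left, Complex.conj_ofReal]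
    simpa using mul_nonneg ht.le (hx.2 ξ)
  obtain ⟨R, h1, h2, h3⟩ := exists_mem_resolvent hA (SMulMemClass.smul_mem (t : ℂ) hx.1) hw
  obtain ⟨hR, hwR⟩ := norm_le_one_of_accretive_of_mul_eq_one hw h1
  have hy : 1 - (t : ℂ) • x * R = R := by
    rw [add_mul, one_mul] at h1
    rw [← h1, add_sub_cancel_right]
  have hcomm : (t : ℂ) • x * R = R * (t : ℂ) • x := by
    rw [add_mul, one_mul] at h1
    rw [mul_add, mul_one, ← h1] at h2
    exact (add_left_cancel h2).symm
  have htx : ∀ z : H →L[ℂ] H, ‖(t : ℂ) • z‖ ≤ 1 → ‖z‖ ≤ t⁻¹ := fun z hz => by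
    rw [norm_smul, Complex.norm_real, Real.norm_of_nonneg ht.le] at hz
    rwa [← one_div, le_div_iff₀' ht]
  refine ⟨(t : ℂ) • x * R, mem_frakF_iff.2 ⟨h3, by rwa [hy]⟩, hwR, ?_, ?_⟩
  · rw [hy]
    exact htx _ (by rwa [← smul_mul_assoc])
  · rw [hy]
    exact htx _ (by rwa [← mul_smul_comm, ← hcomm])

theorem frakR_subset_hereditaryPart (hA : IsClosed (A : Set (H →L[ℂ] H))) :
    frakR A ⊆ (hereditaryPart A : Set (H →L[ℂ] H)) := by
  intro x hx
  choose y hyF hy1 hxy hyx using fun n : ℕ =>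
    exists_frakF_resolvent hA hx (t := (n : ℝ) + 1) (by positivity)
  have hlim : Tendsto (fun n => y n * x * y n) atTop (𝓝 x) := by
    rw [tendsto_iff_norm_sub_tendsto_zero]
    refine squeeze_zero (fun _ => norm_nonneg _) (fun n => ?_)
      (by simpa using tendsto_one_div_add_atTop_nhds_zero_nat.const_mul (2 : ℝ))
      (g := fun n : ℕ => 2 * (1 / ((n : ℝ) + 1)))
    have h1 : y n * x * y n - x = -(y n * (x * (1 - y n)) + (1 - y n) * x) := by noncomm_ring
    rw [h1, norm_neg]
    have h2 : ‖y n * (x * (1 - y n))‖ ≤ 1 * ((n : ℝ) + 1)⁻¹ :=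
      (norm_mul_le _ _).trans (mul_le_mul (hy1 n) (hxy n) (norm_nonneg _) zero_le_one)
    have h3 := norm_add_le (y n * (x * (1 - y n))) ((1 - y n) * x)
    have h4 := hyx n
    rw [one_div]
    linarith
  refine mem_closure_of_tendsto hlim (Eventually.of_forall fun n => ?_)
  exact Submodule.subset_span ⟨y n, hyF n, x, hx.1, y n, hyF n, rfl⟩

/-- For `x, y ∈ 𝔉_A` and a contraction `a ∈ A`, the element `x + y + x a y` is accretive. -/
theorem add_add_mul_mul_mem_frakR {x y a : H →L[ℂ] H} (hx : x ∈ frakF A) (hy : y ∈ frakF A)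
    (ha : a ∈ A) (ha1 : ‖a‖ ≤ 1) : x + y + x * a * y ∈ frakR A := by
  rw [mem_frakF_iff] at hx hy
  refine mem_frakR_iff.2 ⟨add_mem (add_mem hx.1 hy.1) (mul_mem (mul_mem hx.1 ha) hy.1),
    fun ξ => ?_⟩
  -- The cross term is ⟨a yξ, x*ξ⟩, at least -‖yξ‖‖x*ξ‖ in real part; Re x and Re y contribute at
  -- least ‖x*ξ‖²/2 and ‖yξ‖²/2.
  have hx' : ‖1 - star x‖ ≤ 1 := by
    rw [← star_one, ← star_sub, norm_star]
    exact hx.2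
  have h1 := norm_apply_sq_le_of_norm_one_sub_le hx' ξ
  have h2 := norm_apply_sq_le_of_norm_one_sub_le hy.2 ξ
  rw [re_inner_star_apply] at h1
  have h3 : RCLike.re ⟪(x * a * y) ξ, ξ⟫_ℂ = RCLike.re ⟪a (y ξ), (star x) ξ⟫_ℂ := by
    rw [ContinuousLinearMap.star_eq_adjoint, ContinuousLinearMap.adjoint_inner_right]
    rfl
  have h4 : -(‖y ξ‖ * ‖(star x) ξ‖) ≤ RCLike.re ⟪a (y ξ), (star x) ξ⟫_ℂ := by
    have h5 := (abs_le.1 ((RCLike.abs_re_le_norm _).trans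
      (norm_inner_le_norm (𝕜 := ℂ) (a (y ξ)) ((star x) ξ)))).1
    have h6 : ‖a (y ξ)‖ ≤ ‖y ξ‖ := by simpa using a.le_of_opNorm_le ha1 (y ξ)
    have h7 : ‖a (y ξ)‖ * ‖(star x) ξ‖ ≤ ‖y ξ‖ * ‖(star x) ξ‖ := by gcongr
    linarith
  rw [add_apply, add_apply, inner_add_left, inner_add_left, map_add, map_add, h3]
  nlinarith [sq_nonneg (‖y ξ‖ - ‖(star x) ξ‖)]

theorem tripleProducts_subset_span_frakR :
    tripleProducts A ⊆ (Submodule.span ℂ (frakR A) : Set (H →L[ℂ] H)) := by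
  rintro _ ⟨x, hx, a, ha, y, hy, rfl⟩
  have hc : ((‖a‖ + 1 : ℝ) : ℂ) ≠ 0 := by exact_mod_cast (by positivity : ‖a‖ + 1 ≠ 0)
  -- Dividing by ‖a‖ + 1 instead of ‖a‖ covers a = 0.
  set b := ((‖a‖ + 1 : ℝ) : ℂ)⁻¹ • a with hb
  have hb1 : ‖b‖ ≤ 1 := by
    rw [hb, norm_smul, norm_inv, Complex.norm_real, Real.norm_of_nonneg (by positivity),
      inv_mul_le_one₀ (by positivity)]
    linarith
  have hab : a = ((‖a‖ + 1 : ℝ) : ℂ) • b := (smul_inv_smul₀ hc a).symm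
  have h1 : x * b * y = (x + y + x * b * y) - x - y := by abel
  rw [hab, mul_smul_comm, smul_mul_assoc, h1]
  have hsub : frakR A ⊆ (Submodule.span ℂ (frakR A) : Set (H →L[ℂ] H)) := Submodule.subset_span
  exact Submodule.smul_mem _ _ (sub_mem (sub_mem
    (hsub (add_add_mul_mul_mem_frakR hx hy (SMulMemClass.smul_mem _ ha) hb1))
    (hsub (frakF_subset_frakR hx))) (hsub (frakF_subset_frakR hy)))

theorem toSubmodule_hereditaryPart_eq (hA : IsClosed (A : Set (H →L[ℂ] H))) :
    (hereditaryPart A).toSubmodule = (Submodule.span ℂ (frakR A)).topologicalClosure := by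
  apply le_antisymm
  · rw [toSubmodule_hereditaryPart]
    exact Submodule.topologicalClosure_mono (Submodule.span_le.2 tripleProducts_subset_span_frakR)
  · exact Submodule.topologicalClosure_minimal _
      (Submodule.span_le.2 (frakR_subset_hereditaryPart hA))
      (Submodule.isClosed_topologicalClosure _)

theorem frakR_hereditaryPart (hA : IsClosed (A : Set (H →L[ℂ] H))) :
    frakR A = frakR (hereditaryPart A) :=
  Set.Subset.antisymm (fun _ hx => ⟨frakR_subset_hereditaryPart hA hx, hx.2⟩)
    fun _ hx => ⟨hereditaryPart_le hA hx.1, hx.2⟩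

/-- Along a contractive net, `e a → a` is a closed linear condition on `a`, on both sides. -/
theorem isClosed_setOf_tendsto_mul {ι : Type*} {l : Filter ι} {e : ι → H →L[ℂ] H}
    (he : ∀ i, ‖e i‖ ≤ 1) :
    IsClosed {a : H →L[ℂ] H | Tendsto (fun i => e i * a) l (𝓝 a) ∧
      Tendsto (fun i => a * e i) l (𝓝 a)} := by
  refine isClosed_of_closure_subset fun a ha => ?_
  rw [Metric.mem_closure_iff] at ha
  constructor <;> rw [Metric.tendsto_nhds] <;> intro ε hε <;>
    obtain ⟨b, ⟨hb1, hb2⟩, hab⟩ := ha (ε / 3) (by positivity) <;> rw [dist_eq_norm] at hab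
  · filter_upwards [Metric.tendsto_nhds.1 hb1 (ε / 3) (by positivity)] with i hi
    rw [dist_eq_norm] at hi ⊢
    have h1 : e i * a - a = e i * (a - b) + (e i * b - b) - (a - b) := by noncomm_ring
    have h2 : ‖e i * (a - b)‖ ≤ 1 * ‖a - b‖ := (norm_mul_le _ _).trans (by gcongr; exact he i)
    have h3 := norm_sub_le (e i * (a - b) + (e i * b - b)) (a - b)
    have h4 := norm_add_le (e i * (a - b)) (e i * b - b)
    rw [h1]
    linarith
  · filter_upwards [Metric.tendsto_nhds.1 hb2 (ε / 3) (by positivity)] with i hi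
    rw [dist_eq_norm] at hi ⊢
    have h1 : a * e i - a = (a - b) * e i + (b * e i - b) - (a - b) := by noncomm_ring
    have h2 : ‖(a - b) * e i‖ ≤ ‖a - b‖ * 1 := (norm_mul_le _ _).trans (by gcongr; exact he i)
    have h3 := norm_sub_le ((a - b) * e i + (b * e i - b)) (a - b)
    have h4 := norm_add_le ((a - b) * e i) (b * e i - b)
    rw [h1]
    linarith

/-! ### Contractive approximate identity from 𝔉_A -/

theorem sum_mem_frakR (S : Finset (frakF A)) : ∑ x ∈ S, (x : H →L[ℂ] H) ∈ frakR A := by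
  refine mem_frakR_iff.2 ⟨sum_mem fun x _ => x.2.1, fun ξ => ?_⟩
  rw [sum_apply, sum_inner, map_sum]
  exact Finset.sum_nonneg fun x _ => (mem_frakR_iff.1 (frakF_subset_frakR x.2)).2 ξ

theorem re_inner_le_re_inner_sum {S : Finset (frakF A)} {x : frakF A} (hx : x ∈ S) (ξ : H) :
    RCLike.re ⟪(x : H →L[ℂ] H) ξ, ξ⟫_ℂ ≤ RCLike.re ⟪(∑ x ∈ S, (x : H →L[ℂ] H)) ξ, ξ⟫_ℂ := by
  rw [sum_apply, sum_inner, map_sum]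
  exact Finset.single_le_sum (f := fun x : frakF A => RCLike.re ⟪(x : H →L[ℂ] H) ξ, ξ⟫_ℂ)
    (fun x _ => (mem_frakR_iff.1 (frakF_subset_frakR x.2)).2 ξ) hx

/-- The resolvents `n z (1 + n z)⁻¹`, with `z` a finite sum of elements of `𝔉_A`, form a
contractive approximate identity for the hereditary part. -/
theorem hasCai_of_eq_hereditaryPart (hA : IsClosed (A : Set (H →L[ℂ] H)))
    (h : A.toSubmodule = (hereditaryPart A).toSubmodule) : HasCai A := by
  classical
  -- The index is a pair (S, n): enlarging S eventually dominates any given x ∈ 𝔉_A, while the bound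
  -- 1/(n + 1) on z(1 - e) does not depend on S.
  choose e heF he1 hze hez using fun i : Finset (frakF A) × ℕ =>
    exists_frakF_resolvent hA (sum_mem_frakR i.1) (t := (i.2 : ℝ) + 1) (by positivity)
  have hlim0 : Tendsto (fun i : Finset (frakF A) × ℕ => 2 * ((i.2 : ℝ) + 1)⁻¹) atTop (𝓝 0) := by
    rw [← prod_atTop_atTop_eq]
    have h1 : Tendsto (fun n : ℕ => 2 * ((n : ℝ) + 1)⁻¹) atTop (𝓝 0) := by
      simpa using tendsto_one_div_add_atTop_nhds_zero_nat.const_mul (2 : ℝ)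
    exact h1.comp tendsto_snd
  have hsq : ∀ g : Finset (frakF A) × ℕ → H →L[ℂ] H,
      (∀ᶠ i in atTop, ‖g i‖ ^ 2 ≤ 2 * ((i.2 : ℝ) + 1)⁻¹) → Tendsto g atTop (𝓝 0) := fun g hg => by
    have h1 : Tendsto (fun i => ‖g i‖ ^ 2) atTop (𝓝 0) :=
      squeeze_zero' (Eventually.of_forall fun _ => by positivity) hg hlim0
    rw [tendsto_zero_iff_norm_tendsto_zero]
    simpa using h1.sqrt
  have hmem : ∀ x : frakF A, ∀ᶠ i : Finset (frakF A) × ℕ in atTop, x ∈ i.1 := fun x => by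
    filter_upwards [eventually_ge_atTop (({x}, 0) : Finset (frakF A) × ℕ)] with i hi
    exact Finset.singleton_subset_iff.1 hi.1
  have heF' := fun i => mem_frakF_iff.1 (heF i)
  have hF : ∀ x ∈ frakF A, Tendsto (fun i => e i * x) atTop (𝓝 x) ∧
      Tendsto (fun i => x * e i) atTop (𝓝 x) := fun x hx => by
    have hx1 := (mem_frakF_iff.1 hx).2
    have hright : Tendsto (fun i => x * (1 - e i)) atTop (𝓝 0) := hsq _ <| by
      filter_upwards [hmem ⟨x, hx⟩] with i hi
      exact (norm_mul_sq_le_of_re_inner_le hx1 (heF' i).2 (re_inner_le_re_inner_sum hi)).trans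
        (by gcongr; exact hze i)
    have hleft : Tendsto (fun i => (1 - e i) * x) atTop (𝓝 0) := hsq _ <| by
      filter_upwards [hmem ⟨x, hx⟩] with i hi
      -- Passing to adjoints turns left multiplication into right multiplication and preserves real
      -- parts.
      have h1 := norm_mul_sq_le_of_re_inner_le (x := star x) (R := star (1 - e i))
        (z := star (∑ x ∈ i.1, (x : H →L[ℂ] H)))
        (by rw [← star_one, ← star_sub, norm_star]; exact hx1)
        (by rw [norm_star]; exact (heF' i).2)
        (fun ξ => by
          rw [re_inner_star_apply, re_inner_star_apply]; exact re_inner_le_re_inner_sum hi ξ)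
      rw [← star_mul, ← star_mul, norm_star, norm_star] at h1
      exact h1.trans (by gcongr; exact hez i)
    constructor
    · simpa [sub_mul] using hleft.const_sub x
    · simpa [mul_sub] using hright.const_sub x
  have hall : ∀ a ∈ A, Tendsto (fun i => e i * a) atTop (𝓝 a) ∧
      Tendsto (fun i => a * e i) atTop (𝓝 a) := fun a ha => by
    have ha' : a ∈ closure (Submodule.span ℂ (tripleProducts A) : Set (H →L[ℂ] H)) := by
      have h1 : a ∈ A.toSubmodule := ha
      rw [h] at h1
      exact h1
    refine (isClosed_setOf_tendsto_mul he1).closure_subset_iff.2 (fun b hb => ?_) ha'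
    induction hb using Submodule.span_induction with
    | mem z hz =>
      obtain ⟨x, hx, a, ha, y, hy, rfl⟩ := hz
      constructor
      · simpa [mul_assoc] using (hF x hx).1.mul_const (a * y)
      · simpa [mul_assoc] using (hF y hy).2.const_mul (x * a)
    | zero => simp
    | add x y _ _ hx hy =>
      exact ⟨by simpa [mul_add] using hx.1.add hy.1, by simpa [add_mul] using hx.2.add hy.2⟩
    | smul c x _ hx =>
      exact ⟨by simpa using hx.1.const_smul c, by simpa using hx.2.const_smul c⟩
  refine ⟨map (fun i => (⟨e i, (heF i).1⟩ : A)) atTop, ⟨fun m => ?_, fun m => ?_⟩, ?_⟩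
  · rw [tendsto_map'_iff, tendsto_subtype_rng]
    exact (hall m m.2).2
  · rw [tendsto_map'_iff, tendsto_subtype_rng]
    exact (hall m m.2).1
  · exact eventually_map.2 (Eventually.of_forall he1)

/-! ### Accretive decomposition from a contractive approximate identity -/

theorem tendsto_star_mul_mul_half_one_add {ι : Type*} {l : Filter ι} {e : ι → H →L[ℂ] H}
    (he : ∀ᶠ i in l, ‖e i‖ ≤ 1) {x : H →L[ℂ] H} (hex : Tendsto (fun i => e i * x) l (𝓝 x))
    (hxe : Tendsto (fun i => x * e i) l (𝓝 x)) :
    Tendsto (fun i => star ((2⁻¹ : ℂ) • (1 + e i)) * x * ((2⁻¹ : ℂ) • (1 + e i))) l (𝓝 x) := by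
  have hstar : Tendsto (fun i => star (e i) * x) l (𝓝 x) := by
    rw [tendsto_iff_norm_sub_tendsto_zero] at hex ⊢
    have h1 : Tendsto (fun i => ‖star (e i) * x - x‖ ^ 2) l (𝓝 0) :=
      squeeze_zero' (Eventually.of_forall fun _ => by positivity)
        (he.mono fun i hi => norm_star_mul_sub_sq_le hi x)
        (by simpa using hex.const_mul (2 * ‖x‖))
    simpa using h1.sqrt
  have hboth : Tendsto (fun i => star (e i) * x * e i) l (𝓝 x) := by
    have h1 : Tendsto (fun i => star (e i) * (x * e i - x)) l (𝓝 0) := by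
      rw [tendsto_iff_norm_sub_tendsto_zero] at hxe
      refine squeeze_zero_norm' (he.mono fun i hi => ?_) hxe
      refine (norm_mul_le _ _).trans (mul_le_of_le_one_left (norm_nonneg _) ?_)
      rwa [norm_star]
    simpa [mul_sub, mul_assoc] using h1.add hstar
  -- The four terms of (1 + e)* x (1 + e) each tend to x.
  have h := (((tendsto_const_nhds (x := x)).add hstar).add (hxe.add hboth)).const_smul (4⁻¹ : ℂ)
  have hx : (4⁻¹ : ℂ) • (x + x + (x + x)) = x := by module
  rw [hx] at h
  refine h.congr fun i => ?_
  have h2 : star (2⁻¹ : ℂ) = 2⁻¹ := by simp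
  rw [star_smul, h2, star_add, star_one, smul_mul_assoc, smul_mul_smul_comm,
    show (2⁻¹ : ℂ) * 2⁻¹ = 4⁻¹ by norm_num]
  congr 1
  noncomm_ring

/-- Given a contractive approximate identity, adding to `x` a multiple of a contraction of `A`
improves a negative lower bound of the real part of `x` by a fixed factor. -/
theorem eventually_re_inner_add_smul {l : Filter A} (hl : l.IsApproximateUnit)
    (hl1 : ∀ᶠ e in l, ‖e‖ ≤ 1) {x : H →L[ℂ] H} (hxA : x ∈ A) {η : ℝ} (hη : 0 < η)
    (hx : ∀ ξ, -(η * ‖ξ‖ ^ 2) ≤ RCLike.re ⟪x ξ, ξ⟫_ℂ) :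
    ∀ᶠ e : A in l, ∀ ξ, -(3 / 4 * η * ‖ξ‖ ^ 2) ≤
      RCLike.re ⟪(x + ((η / 2 : ℝ) : ℂ) • (e : H →L[ℂ] H)) ξ, ξ⟫_ℂ := by
  have hex : Tendsto (fun e : A => (e : H →L[ℂ] H) * x) l (𝓝 x) :=
    (continuous_subtype_val.tendsto _).comp (hl.tendsto_mul_right ⟨x, hxA⟩)
  have hxe : Tendsto (fun e : A => x * (e : H →L[ℂ] H)) l (𝓝 x) :=
    (continuous_subtype_val.tendsto _).comp (hl.tendsto_mul_left ⟨x, hxA⟩)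
  -- The loss 3η/4 is η/2 from the compression plus η/4 from replacing the compressed x by x.
  filter_upwards [hl1, Metric.tendsto_nhds.1 (tendsto_star_mul_mul_half_one_add
    (e := fun e : A => (e : H →L[ℂ] H)) hl1 hex hxe) (η / 4) (by positivity)] with e he hclose ξ
  have h1 := neg_half_le_re_inner_compress_add (e := (e : H →L[ℂ] H)) hη.le he hx ξ
  set y := star ((2⁻¹ : ℂ) • (1 + (e : H →L[ℂ] H))) * x * ((2⁻¹ : ℂ) • (1 + (e : H →L[ℂ] H)))
  rw [dist_eq_norm, norm_sub_rev] at hclose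
  have h2 := neg_norm_mul_sq_le_re_inner (x - y) ξ
  have h3 : ‖x - y‖ * ‖ξ‖ ^ 2 ≤ η / 4 * ‖ξ‖ ^ 2 := by gcongr
  have h4 : x + ((η / 2 : ℝ) : ℂ) • (e : H →L[ℂ] H) =
      (y + ((η / 2 : ℝ) : ℂ) • (e : H →L[ℂ] H)) + (x - y) := by abel
  rw [h4, add_apply, inner_add_left, map_add]
  linarith

theorem mem_span_frakR_of_hasCai (hA : IsClosed (A : Set (H →L[ℂ] H))) (h : HasCai A)
    {a : H →L[ℂ] H} (ha : a ∈ A) : a ∈ Submodule.span ℂ (frakR A) := by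
  obtain ⟨l, hl, hl1⟩ := h
  have := hl.neBot
  set η : ℕ → ℝ := fun n => (‖a‖ + 1) * (3 / 4) ^ n with hη
  have hηpos : ∀ n, 0 < η n := fun n => by positivity
  -- One c must serve both a and -a; this is possible because the same e can be chosen far along the
  -- filter for both.
  let P : ℕ → (H →L[ℂ] H) → Prop := fun n c => c ∈ A ∧
    (∀ ξ, -(η n * ‖ξ‖ ^ 2) ≤ RCLike.re ⟪(c + a) ξ, ξ⟫_ℂ) ∧
    ∀ ξ, -(η n * ‖ξ‖ ^ 2) ≤ RCLike.re ⟪(c - a) ξ, ξ⟫_ℂ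
  have hstep : ∀ n (c : {c // P n c}), ∃ c' : {c // P (n + 1) c}, ‖c.1 - c'.1‖ ≤ η n := by
    rintro n ⟨c, hc, hp, hm⟩
    obtain ⟨e, he1, hep, hem⟩ := (hl1.and
      ((eventually_re_inner_add_smul hl hl1 (add_mem hc ha) (hηpos n) hp).and
      (eventually_re_inner_add_smul hl hl1 (sub_mem hc ha) (hηpos n) hm))).exists
    have hsucc : η (n + 1) = 3 / 4 * η n := by simp only [hη, pow_succ]; ring
    refine ⟨⟨c + ((η n / 2 : ℝ) : ℂ) • (e : H →L[ℂ] H),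
      add_mem hc (SMulMemClass.smul_mem _ e.2), fun ξ => ?_, fun ξ => ?_⟩, ?_⟩
    · rw [hsucc, add_right_comm]
      exact hep ξ
    · rw [hsucc, add_sub_right_comm]
      exact hem ξ
    · have he1' : ‖(e : H →L[ℂ] H)‖ ≤ 1 := he1
      rw [sub_add_cancel_left, norm_neg, norm_smul, Complex.norm_real,
        Real.norm_of_nonneg (by linarith [hηpos n])]
      nlinarith [hηpos n, norm_nonneg (e : H →L[ℂ] H)]
  choose next hnext using hstep
  have hzero : P 0 0 := by
    refine ⟨zero_mem A, fun ξ => ?_, fun ξ => ?_⟩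
    · have := neg_norm_mul_sq_le_re_inner a ξ
      simp only [hη, pow_zero, mul_one, zero_add]
      nlinarith [sq_nonneg ‖ξ‖]
    · have := neg_norm_mul_sq_le_re_inner (-a) ξ
      simp only [hη, pow_zero, mul_one, zero_sub]
      rw [norm_neg] at this
      nlinarith [sq_nonneg ‖ξ‖]
  let c : ∀ n, {c // P n c} := fun n => Nat.rec ⟨0, hzero⟩ next n
  have hcauchy : CauchySeq fun n => (c n).1 := by
    refine cauchySeq_of_le_geometric (3 / 4) (‖a‖ + 1) (by norm_num) fun n => ?_
    rw [dist_eq_norm]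
    exact hnext n (c n)
  obtain ⟨d, hd⟩ := cauchySeq_tendsto_of_complete hcauchy
  have hdA : d ∈ A := hA.mem_of_tendsto hd (Eventually.of_forall fun n => (c n).2.1)
  have hη0 : Tendsto η atTop (𝓝 0) := by
    simpa using (tendsto_pow_atTop_nhds_zero_of_lt_one (by norm_num : (0 : ℝ) ≤ 3 / 4)
      (by norm_num)).const_mul (‖a‖ + 1)
  have hlim : ∀ b : H →L[ℂ] H,
      (∀ n ξ, -(η n * ‖ξ‖ ^ 2) ≤ RCLike.re ⟪((c n).1 + b) ξ, ξ⟫_ℂ) →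
      ∀ ξ, 0 ≤ RCLike.re ⟪(d + b) ξ, ξ⟫_ℂ := fun b hb ξ => by
    have hcont : Continuous fun T : H →L[ℂ] H => RCLike.re ⟪(T + b) ξ, ξ⟫_ℂ := by fun_prop
    refine le_of_tendsto_of_tendsto' ?_ ((hcont.tendsto d).comp hd) fun n => hb n ξ
    simpa using (hη0.mul_const (‖ξ‖ ^ 2)).neg
  have hp : d + a ∈ frakR A :=
    mem_frakR_iff.2 ⟨add_mem hdA ha, hlim a fun n => (c n).2.2.1⟩
  have hm : d - a ∈ frakR A := mem_frakR_iff.2 ⟨sub_mem hdA ha, by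
    rw [sub_eq_add_neg]
    exact hlim (-a) fun n ξ => by rw [← sub_eq_add_neg]; exact (c n).2.2.2 ξ⟩
  have hsplit : a = (2⁻¹ : ℂ) • ((d + a) - (d - a)) := by module
  rw [hsplit]
  exact Submodule.smul_mem _ _ (sub_mem (Submodule.subset_span hp) (Submodule.subset_span hm))

theorem hasCai_iff (hA : IsClosed (A : Set (H →L[ℂ] H))) :
    HasCai A ↔ A.toSubmodule = (Submodule.span ℂ (frakR A)).topologicalClosure := by
  refine ⟨fun h => le_antisymm (fun a ha => ?_) ?_, fun h => ?_⟩
  · exact Submodule.le_topologicalClosure _ (mem_span_frakR_of_hasCai hA h ha)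
  · exact Submodule.topologicalClosure_minimal _ (Submodule.span_le.2 fun _ hx => hx.1) hA
  · exact hasCai_of_eq_hereditaryPart hA (h.trans (toSubmodule_hereditaryPart_eq hA).symm)

end Algebras

end OperatorAlgebra

theorem corollary4p4 {H : Type*} [NormedAddCommGroup H] [InnerProductSpace ℂ H] [CompleteSpace H]
    (A : NonUnitalSubalgebra ℂ (H →L[ℂ] H)) (hA : IsClosed (A : Set (H →L[ℂ] H))) :
    ((OperatorAlgebra.hereditaryPart A).toSubmodule =
        (Submodule.span ℂ (OperatorAlgebra.frakR A)).topologicalClosure ∧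
      OperatorAlgebra.frakR A = OperatorAlgebra.frakR (OperatorAlgebra.hereditaryPart A) ∧
      OperatorAlgebra.frakR A ⊆ (OperatorAlgebra.hereditaryPart A : Set (H →L[ℂ] H))) ∧
    (OperatorAlgebra.HasCai A ↔
      A.toSubmodule = (Submodule.span ℂ (OperatorAlgebra.frakR A)).topologicalClosure) := by
  exact ⟨⟨OperatorAlgebra.toSubmodule_hereditaryPart_eq hA, OperatorAlgebra.frakR_hereditaryPart hA,
    OperatorAlgebra.frakR_subset_hereditaryPart hA⟩, OperatorAlgebra.hasCai_iff hA⟩
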